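/- Definitions. For a finite set $S\subset\mathbb{R}^d$, a $t$-spanner for $S$ is a graph $G$ on the vertex set $S$ in which any two points $a,b\in S$ are joined by a path of Euclidean length at most $t\|ab\|$; its weight is the sum of the Euclidean lengths of its edges, and $\mathrm{OPT}_t(S)$ is the minimum weight of a $t$-spanner for $S$. An online $t$-spanner algorithm $A$ maintains, for a sequence $\sigma$ of points presented one by one, a $t$-spanner $A(\sigma)$ for the set of points presented so far, and never removes an edge. Its competitive ratio on $n$ points is $\sup_\sigma \mathrm{weight}(A(\sigma))/\mathrm{OPT}_t(\sigma)$ over all sequences $\sigma$ of $n$ points (with $0/0=0$). The incremental quadtree/WSPD spanner algorithm (Fischer and Har-Peled) with parameters $\varepsilon$, $0<c_1<c_2$ and $\kappa$. As soon as the set $S$ of points presented so far contains two distinct points, maintain a quadtree for $S$: its root (level $0$) is an axis-parallel half-open cube $Q_0\supseteq S$ of side length $a_0\le\kappa\,\mathrm{diam}(S)$, and level $\ell$ consists of the $2^{d\ell}$ congruent disjoint subcubes of $Q_0$ of side length $a_0/2^\ell$. When a point is inserted, the root may be replaced by a larger cube, but the old root must be a cube of the new quadtree. Every nonempty cube $Q$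 has an arbitrarily chosen representative $s(Q)\in Q\cap S$, which never changes once it is chosen. The graph $G$ maintained by the algorithm has vertex set $S$ and edge set $\bigcup_{\ell\ge 0}E_\ell$, where $E_\ell$ consists of all edges $s(Q_1)s(Q_2)$ for nonempty cubes $Q_1,Q_2$ at level $\ell$ with $$\frac{c_1a_0}{\varepsilon 2^\ell}\le\|s(Q_1)s(Q_2)\|\le\frac{c_2a_0}{\varepsilon 2^\ell}.$$ Theorem. Let $d\ge 2$ be an integer. (a) For some $\kappa$ there is a rule that carries out the maintenance of the quadtree and of the representatives as above for every sequence of points in $\mathbb{R}^d$. (b) There are constants $0<c_1<c_2$, depending only on $d$, such that for every $\kappa$, every choice of roots and representatives as above, and every $0<\varepsilon\le 1$, the algorithm is an online $(1+\varepsilon)$-spanner algorithm. (c) For all $\kappa$ and all $0<c_1<c_2$ there is a constant $C>0$, depending only on $d,\kappa,c_1,c_2$, such that for every choice of roots and representatives as above, every $0<\varepsilon\le1$ and every $n\in\mathbb{N}$, $$\sup_{\sigma}\ \frac{\mathrm{weight}(G(\sigma))}{\mathrm{OPT}_{1+\varepsilon}(\sigma)}\le C\,\varepsilon^{-(d+1)}\log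 n,$$ where the supremum is over all sequences $\sigma$ of $n$ points in $\mathbb{R}^d$. In particular, with the constants of (a) and (b), the competitive ratio of the algorithm is $O(\varepsilon^{-(d+1)}\log n)$. -/

import Mathlib

open scoped ENNReal

namespace OnlineSpanner

/-- Euclidean `d`-space. -/
abbrev Pt (d : ℕ) : Type := EuclideanSpace ℝ (Fin d)

/-! ### Geometric graphs and spanners -/

/-- The Euclidean weight of a graph whose vertices are points of `d`-space: the sum of the lengths
of its edges. -/
noncomputable def weight {d : ℕ} (G : SimpleGraph (Pt d)) : ℝ≥0∞ :=
  ∑' e : G.edgeSet, Sym2.lift ⟨fun a b : Pt d => edist a b, fun a b => edist_comm a b⟩ (e : Sym2 (Pt d))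

/-- The Euclidean length of a walk. -/
noncomputable def walkLength {d : ℕ} {G : SimpleGraph (Pt d)} {a b : Pt d} (w : G.Walk a b) : ℝ :=
  (w.darts.map fun e => dist e.fst e.snd).sum

/-- `G` is a `t`-spanner for `S`: a subgraph of the complete graph on `S` in which any two points
`a`, `b` of `S` are joined by a path of length at most `t * ‖ab‖`. -/
def IsSpanner {d : ℕ} (t : ℝ) (S : Set (Pt d)) (G : SimpleGraph (Pt d)) : Prop :=
  (∀ a b, G.Adj a b → a ∈ S ∧ b ∈ S) ∧
    ∀ a ∈ S, ∀ b ∈ S, ∃ w : G.Walk a b, walkLength w ≤ t * dist a b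

/-- `OPT`: the minimum weight of a `t`-spanner for `S`. -/
noncomputable def optWeight {d : ℕ} (t : ℝ) (S : Set (Pt d)) : ℝ≥0∞ :=
  ⨅ (G : SimpleGraph (Pt d)) (_ : IsSpanner t S G), weight G

/-! ### Online algorithms -/

/-- The set of points of a finite sequence. -/
def pts {d : ℕ} (σ : List (Pt d)) : Set (Pt d) := {x | x ∈ σ}

/-- `A σ` is the graph maintained after the points of `σ` have been presented one by one. `A` is an
online `t`-spanner algorithm if this graph is always a `t`-spanner for the points presented so far,
and no edge is ever removed. -/
def IsOnlineSpannerAlgorithm {d : ℕ} (t : ℝ) (A : List (Pt d) → SimpleGraph (Pt d)) : Prop :=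
  (∀ σ, IsSpanner t (pts σ) (A σ)) ∧ ∀ σ p, A σ ≤ A (σ ++ [p])

/-- The competitive ratio `sup ALG(σ) / OPT(σ)` over all sequences `σ` of `n` points
(with `0 / 0 = 0`, and `x / 0 = ∞` for `x > 0`). -/
noncomputable def competitiveRatio {d : ℕ} (t : ℝ) (A : List (Pt d) → SimpleGraph (Pt d))
    (n : ℕ) : ℝ≥0∞ :=
  ⨆ (σ : List (Pt d)) (_ : σ.length = n), weight (A σ) / optWeight t (pts σ)

/-! ### Quadtrees -/

/-- An axis-parallel cube, given by its lowest corner and its side length. -/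
structure Cube (d : ℕ) where
  corner : Pt d
  side : ℝ

/-- The point set of a cube; cubes are half-open, so that the cells of a level partition the root. -/
def Cube.carrier {d : ℕ} (Q : Cube d) : Set (Pt d) :=
  {x | ∀ i, Q.corner i ≤ x i ∧ x i < Q.corner i + Q.side}

/-- The `2 ^ (d * l)` cubes at level `l` of the quadtree with root `Q`. -/
def Cube.cells {d : ℕ} (Q : Cube d) (l : ℕ) : Set (Cube d) :=
  {R | R.side = Q.side / 2 ^ l ∧
    ∃ z : Fin d → ℕ, ∀ i, z i < 2 ^ l ∧ R.corner i = Q.corner i + z i * (Q.side / 2 ^ l)}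

/-- A rule for maintaining a quadtree with representatives under point insertions. All choices
that depend on the points presented so far are free, subject to the listed conditions. The quadtree
starts when two distinct points are present. -/
structure IncrementalQuadtree (d : ℕ) (κ : ℝ) where
  /-- the root cube of the quadtree of the points of `σ` -/
  root : List (Pt d) → Cube d
  /-- the representatives of the nonempty cubes -/
  rep : List (Pt d) → Cube d → Pt d
  side_pos : ∀ σ, 0 < (root σ).side
  subset_root : ∀ σ, pts σ ⊆ (root σ).carrier
  /-- The side length of the root is of order the diameter
  (the reverse bound `diam ≤ √d * side` follows from `subset_root`). -/
  side_le : ∀ σ, (pts σ).Nontrivial → (root σ).side ≤ κ * Metric.diam (pts σ)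
  /-- No cube is ever deleted: the old quadtree is a subtree of the new one. -/
  root_mem_cells : ∀ σ p, (pts σ).Nontrivial → ∃ k, root σ ∈ (root (σ ++ [p])).cells k
  /-- The representative of a nonempty cube is one of its points. -/
  rep_mem : ∀ σ l, ∀ Q ∈ (root σ).cells l, (Q.carrier ∩ pts σ).Nonempty →
    rep σ Q ∈ Q.carrier ∩ pts σ
  /-- A representative is never changed. -/
  rep_append : ∀ σ p l, (pts σ).Nontrivial → ∀ Q ∈ (root σ).cells l,
    (Q.carrier ∩ pts σ).Nonempty → rep (σ ++ [p]) Q = rep σ Q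

/-- `a` and `b` are the representatives of two nonempty cubes at level `l`, and the distance
between them lies in `[c₁ a₀ / (ε 2^l), c₂ a₀ / (ε 2^l)]`, where `a₀` is the side of the root. -/
def IncrementalQuadtree.LevelEdge {d : ℕ} {κ : ℝ} (T : IncrementalQuadtree d κ) (c₁ c₂ ε : ℝ)
    (σ : List (Pt d)) (l : ℕ) (a b : Pt d) : Prop :=
  ∃ Q₁ ∈ (T.root σ).cells l, ∃ Q₂ ∈ (T.root σ).cells l,
    (Q₁.carrier ∩ pts σ).Nonempty ∧ (Q₂.carrier ∩ pts σ).Nonempty ∧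
    a = T.rep σ Q₁ ∧ b = T.rep σ Q₂ ∧
    c₁ * (T.root σ).side / (ε * 2 ^ l) ≤ dist a b ∧
    dist a b ≤ c₂ * (T.root σ).side / (ε * 2 ^ l)

theorem IncrementalQuadtree.LevelEdge.symm {d : ℕ} {κ : ℝ} {T : IncrementalQuadtree d κ}
    {c₁ c₂ ε : ℝ} {σ : List (Pt d)} {l : ℕ} {a b : Pt d} (h : T.LevelEdge c₁ c₂ ε σ l a b) :
    T.LevelEdge c₁ c₂ ε σ l b a := by
  obtain ⟨Q₁, h₁, Q₂, h₂, n₁, n₂, ha, hb, hl, hu⟩ := h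
  exact ⟨Q₂, h₂, Q₁, h₁, n₂, n₁, hb, ha, dist_comm a b ▸ hl, dist_comm a b ▸ hu⟩

/-- The graph maintained by the incremental quadtree / WSPD spanner algorithm: the union of the
edge sets of all levels. -/
def IncrementalQuadtree.spanner {d : ℕ} {κ : ℝ} (T : IncrementalQuadtree d κ) (c₁ c₂ ε : ℝ)
    (σ : List (Pt d)) : SimpleGraph (Pt d) where
  Adj a b := a ≠ b ∧ ∃ l : ℕ, T.LevelEdge c₁ c₂ ε σ l a b
  symm := ⟨fun _ _ h => ⟨h.1.symm, h.2.imp fun _ hl => hl.symm⟩⟩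
  loopless := ⟨fun _ h => h.1 rfl⟩

end OnlineSpanner

namespace OnlineSpanner

/-! ### Cells of a quadtree -/

/-! Existence: around the first point, build an increasing chain of cubes with doubling sides, each
a corner child of the next, the point staying in the middle half of every cube. The root is the
first chain cube that contains all points, and the earliest point of a cube represents it
(`chainQuadtree`).

Spanner property (`isSpanner_spanner`): take a pair `a`, `b` without a good path, at minimal
distance. At a suitable level its cells are smaller than `dist a b` by a factor of order `ε`; their
representatives are joined by an edge, and the short hops from `a` and `b` to them have good paths
by minimality. The detour is at most `ε * dist a b`.

Competitive ratio: let level `l` have `m` representatives and cell side `a`. By packing, each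
representative has `O(ε ^ (-d))` neighbours at this level, over edges of length `O(a / ε)`, so the
level weighs `O(ε ^ (-(d + 1)) * m * a)` (`weight_levelGraph_le`). Every graph connecting the points
weighs at least a constant times `m * a` (`card_reps_mul_side_le`, from `card_mul_le_weight`). So
each level costs `O(ε ^ (-(d + 1)))` times the optimum. Since also `m ≤ n`, the bounds decay
geometrically after about `log₂ n` levels, and the sum over all levels costs only a factor `O(log
n)` (`tsum_le_of_le_of_le_geometric`). -/

theorem abs_sub_apply_le_dist {d : ℕ} (x y : Pt d) (i : Fin d) : |x i - y i| ≤ dist x y := by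
  have h := PiLp.norm_apply_le (x - y) i
  rwa [← dist_eq_norm, PiLp.sub_apply, Real.norm_eq_abs] at h

theorem Cube.ext {d : ℕ} {Q R : Cube d} (hc : ∀ i, Q.corner i = R.corner i)
    (hs : Q.side = R.side) : Q = R := by
  cases Q; cases R
  simp only [Cube.mk.injEq]
  exact ⟨PiLp.ext hc, hs⟩

theorem Cube.dist_le {d : ℕ} {Q : Cube d} {x y : Pt d} (hx : x ∈ Q.carrier) (hy : y ∈ Q.carrier)
    (hs : 0 ≤ Q.side) : dist x y ≤ √d * Q.side := by
  rw [EuclideanSpace.dist_eq, ← Real.sqrt_sq hs, ← Real.sqrt_mul (Nat.cast_nonneg d)]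
  refine Real.sqrt_le_sqrt ?_
  calc ∑ i, dist (x i) (y i) ^ 2 ≤ ∑ _i : Fin d, Q.side ^ 2 := by
        refine Finset.sum_le_sum fun i _ => pow_le_pow_left₀ dist_nonneg ?_ 2
        rw [Real.dist_eq, abs_le]
        constructor <;> linarith [(hx i).1, (hx i).2, (hy i).1, (hy i).2]
    _ = d * Q.side ^ 2 := by simp

theorem Cube.side_of_mem_cells {d : ℕ} {Q R : Cube d} {l : ℕ} (h : R ∈ Q.cells l) :
    R.side = Q.side / 2 ^ l := h.1

theorem Cube.mem_cells_trans {d : ℕ} {Q R R' : Cube d} {k l : ℕ} (h : R ∈ Q.cells k)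
    (h' : R' ∈ R.cells l) : R' ∈ Q.cells (k + l) := by
  obtain ⟨hs, z, hz⟩ := h
  obtain ⟨hs', z', hz'⟩ := h'
  refine ⟨by rw [hs', hs, pow_add, div_div], fun i => z i * 2 ^ l + z' i, fun i => ⟨?_, ?_⟩⟩
  · have h1 := (hz i).1
    have h2 := (hz' i).1
    calc z i * 2 ^ l + z' i < z i * 2 ^ l + 2 ^ l := by omega
      _ = (z i + 1) * 2 ^ l := by ring
      _ ≤ 2 ^ k * 2 ^ l := Nat.mul_le_mul_right _ h1
      _ = 2 ^ (k + l) := by rw [pow_add]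
  · rw [(hz' i).2, (hz i).2, hs, pow_add]
    push_cast
    field_simp
    ring

theorem Cube.exists_mem_cells {d : ℕ} {Q : Cube d} (hs : 0 < Q.side) {x : Pt d}
    (hx : x ∈ Q.carrier) (l : ℕ) : ∃ R ∈ Q.cells l, x ∈ R.carrier := by
  have ha : 0 < Q.side / 2 ^ l := by positivity
  set a := Q.side / 2 ^ l with hadef
  have hnn : ∀ i, 0 ≤ (x i - Q.corner i) / a := fun i =>
    div_nonneg (by linarith [(hx i).1]) ha.le
  refine ⟨⟨WithLp.toLp 2 fun i => Q.corner i + (⌊(x i - Q.corner i) / a⌋₊ : ℕ) * a, a⟩,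
    ⟨rfl, fun i => ⌊(x i - Q.corner i) / a⌋₊, fun i => ⟨?_, rfl⟩⟩, fun i => ?_⟩
  · rw [Nat.floor_lt (hnn i), div_lt_iff₀ ha]
    push_cast
    rw [hadef, mul_div_cancel₀ _ (by positivity)]
    linarith [(hx i).2]
  · have h1 := Nat.floor_le (hnn i)
    have h2 := Nat.lt_floor_add_one ((x i - Q.corner i) / a)
    rw [le_div_iff₀ ha] at h1
    rw [div_lt_iff₀ ha] at h2
    constructor <;> simp only <;> linarith

theorem Cube.floor_eq {d : ℕ} {Q R : Cube d} (hs : 0 < Q.side) {l : ℕ} (h : R ∈ Q.cells l)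
    {x : Pt d} (hx : x ∈ R.carrier) (i : Fin d) :
    R.corner i = Q.corner i + ⌊(x i - Q.corner i) / (Q.side / 2 ^ l)⌋ * (Q.side / 2 ^ l) := by
  obtain ⟨hR, z, hz⟩ := h
  have ha : 0 < Q.side / 2 ^ l := by positivity
  have h1 := hx i
  rw [hR, (hz i).2] at h1
  have : ⌊(x i - Q.corner i) / (Q.side / 2 ^ l)⌋ = (z i : ℤ) := by
    rw [Int.floor_eq_iff, le_div_iff₀ ha, div_lt_iff₀ ha]
    push_cast
    constructor <;> linarith [h1.1, h1.2]
  rw [this, (hz i).2]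
  push_cast
  rfl

theorem Cube.eq_of_floor_eq {d : ℕ} {Q R R' : Cube d} (hs : 0 < Q.side) {l : ℕ}
    (h : R ∈ Q.cells l) (h' : R' ∈ Q.cells l) {x y : Pt d} (hx : x ∈ R.carrier)
    (hy : y ∈ R'.carrier)
    (hxy : ∀ i, ⌊(x i - Q.corner i) / (Q.side / 2 ^ l)⌋ = ⌊(y i - Q.corner i) / (Q.side / 2 ^ l)⌋) :
    R = R' :=
  Cube.ext (fun i => by rw [floor_eq hs h hx, floor_eq hs h' hy, hxy]) (h.1.trans h'.1.symm)

/-- Points in distinct cells of a grid of width `a`: a packing bound. -/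
theorem card_filter_dist_le {d : ℕ} (P : Finset (Pt d)) (c : Pt d) {a r : ℝ} (ha : 0 < a)
    (hr : 0 ≤ r)
    (hP : Set.InjOn (fun (x : Pt d) (i : Fin d) => ⌊(x i - c i) / a⌋) (P : Set (Pt d)))
    (x : Pt d) : ((P.filter fun y => dist x y ≤ r).card : ℝ) ≤ (2 * (r / a) + 2) ^ d := by
  classical
  let lo : Fin d → ℤ := fun i => ⌊(x i - c i - r) / a⌋
  let hi : Fin d → ℤ := fun i => ⌊(x i - c i + r) / a⌋
  have hcard : (P.filter fun y => dist x y ≤ r).card ≤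
      (Fintype.piFinset fun i => Finset.Icc (lo i) (hi i)).card := by
    refine Finset.card_le_card_of_injOn (fun (x : Pt d) (i : Fin d) => ⌊(x i - c i) / a⌋) ?_
      (hP.mono fun y hy => (Finset.mem_filter.1 hy).1)
    intro y hy
    have hd := (Finset.mem_filter.1 hy).2
    simp only [Finset.mem_coe, Fintype.mem_piFinset, Finset.mem_Icc]
    intro i
    have hi := abs_le.1 ((abs_sub_apply_le_dist x y i).trans hd)
    exact ⟨Int.floor_le_floor (div_le_div_of_nonneg_right (by linarith) ha.le),
      Int.floor_le_floor (div_le_div_of_nonneg_right (by linarith) ha.le)⟩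
  calc ((P.filter fun y => dist x y ≤ r).card : ℝ)
      ≤ ((Fintype.piFinset fun i => Finset.Icc (lo i) (hi i)).card : ℝ) := by exact_mod_cast hcard
    _ = ∏ i : Fin d, ((Finset.Icc (lo i) (hi i)).card : ℝ) := by
        rw [Fintype.card_piFinset]; push_cast; rfl
    _ ≤ ∏ _i : Fin d, (2 * (r / a) + 2) := by
        refine Finset.prod_le_prod (fun _ _ => Nat.cast_nonneg _) fun i _ => ?_
        have hlo : lo i ≤ hi i := Int.floor_le_floor (by gcongr; linarith)
        have h1 : ((Finset.Icc (lo i) (hi i)).card : ℤ) = hi i + 1 - lo i := by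
          rw [Int.card_Icc, Int.toNat_of_nonneg (by omega)]
        have h2 : ((Finset.Icc (lo i) (hi i)).card : ℝ) = hi i + 1 - lo i := by exact_mod_cast h1
        have h3 : (hi i : ℝ) ≤ (x i - c i + r) / a := Int.floor_le _
        have h4 : (x i - c i - r) / a < lo i + 1 := Int.lt_floor_add_one _
        have h5 : (x i - c i + r) / a = (x i - c i - r) / a + 2 * (r / a) := by ring
        rw [h2]; linarith
    _ = _ := by simp

/-! ### A lower bound for the weight of a connected graph -/

/-- The length of an edge after applying a map to its ends. -/
noncomputable def edgeLength {d : ℕ} {X : Type*} [PseudoEMetricSpace X] (f : Pt d → X) :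
    Sym2 (Pt d) → ℝ≥0∞ :=
  Sym2.lift ⟨fun a b => edist (f a) (f b), fun a b => edist_comm (f a) (f b)⟩

theorem weight_eq {d : ℕ} (G : SimpleGraph (Pt d)) :
    weight G = ∑' e : G.edgeSet, edgeLength id (e : Sym2 (Pt d)) := rfl

theorem edist_le_sum_edges {d : ℕ} {X : Type*} [PseudoEMetricSpace X] (f : Pt d → X)
    {G : SimpleGraph (Pt d)} {a b : Pt d} (w : G.Walk a b) :
    edist (f a) (f b) ≤ (w.edges.map (edgeLength f)).sum := by
  induction w with
  | nil => simp
  | @cons u v w h p ih =>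
    rw [SimpleGraph.Walk.edges_cons, List.map_cons, List.sum_cons]
    exact (edist_triangle _ (f v) _).trans (add_le_add le_rfl ih)

/-- The walk is shortcut to a path, so that no edge is counted twice. -/
theorem edist_le_tsum_edgeLength {d : ℕ} {X : Type*} [PseudoEMetricSpace X] (f : Pt d → X)
    {G : SimpleGraph (Pt d)} {a b : Pt d} (w : G.Walk a b) :
    edist (f a) (f b) ≤ ∑' e : G.edgeSet, edgeLength f (e : Sym2 (Pt d)) := by
  classical
  refine (edist_le_sum_edges f w.bypass).trans ?_
  have hn : w.bypass.edges.Nodup := (w.bypass_isPath).isTrail.edges_nodup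
  rw [← List.sum_toFinset _ hn, tsum_subtype]
  calc _ = ∑ e ∈ w.bypass.edges.toFinset, G.edgeSet.indicator (edgeLength f) e :=
        Finset.sum_congr rfl fun e he => (Set.indicator_of_mem
          (w.bypass.edges_subset_edgeSet (List.mem_toFinset.1 he)) _).symm
    _ ≤ _ := ENNReal.sum_le_tsum _

/-- The test function `φ s = min (dist s ·) a` is 1-Lipschitz and constant outside the ball of
radius `a` around `s`. A walk from `s` to `q` makes it grow by at least `δ`, so its total variation
over the edges of `G` is at least `δ`. An edge contributes only for those `s` within `a` of one of
its ends, at most `2 * M` of them, so summing over `s ∈ P` and exchanging sums gives the bound. -/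
theorem card_mul_le_weight {d : ℕ} (P : Finset (Pt d)) {a δ : ℝ} {M : ℕ} (hδ : δ ≤ a)
    (hδ0 : 0 ≤ δ) (hM : ∀ x, (P.filter fun y => dist x y ≤ a).card ≤ M) (G : SimpleGraph (Pt d))
    (hG : ∀ s ∈ P, ∃ q, δ ≤ dist s q ∧ Nonempty (G.Walk s q)) :
    P.card * ENNReal.ofReal δ ≤ 2 * M * weight G := by
  classical
  let φ : Pt d → Pt d → ℝ := fun s z => min (dist s z) a
  have hedge : ∀ e : Sym2 (Pt d), ∑ s ∈ P, edgeLength (φ s) e ≤ 2 * M * edgeLength id e := by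
    intro e
    induction e with | _ x y =>
    have hval : ∀ s, edgeLength (φ s) s(x, y) = edist (φ s x) (φ s y) := fun s => rfl
    have hval' : edgeLength id s(x, y) = edist x y := rfl
    have hle : ∀ s, edgeLength (φ s) s(x, y) ≤ edist x y := by
      intro s
      rw [hval]
      have h : LipschitzWith 1 (φ s) := (LipschitzWith.dist_right s).min_const a
      simpa using h x y
    have hzero : ∀ s ∈ P, s ∉ (P.filter fun s => dist x s ≤ a) ∪ (P.filter fun s => dist y s ≤ a) →
        edgeLength (φ s) s(x, y) = 0 := by
      intro s hs hn
      simp only [Finset.mem_union, Finset.mem_filter, hs, true_and, not_or, not_le] at hn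
      rw [hval]
      simp only [φ]
      rw [min_eq_right (by rw [dist_comm]; exact hn.1.le),
        min_eq_right (by rw [dist_comm]; exact hn.2.le), edist_self]
    rw [← Finset.sum_subset (Finset.union_subset (Finset.filter_subset _ _)
      (Finset.filter_subset _ _)) hzero, hval']
    refine (Finset.sum_le_card_nsmul _ _ _ fun s _ => hle s).trans ?_
    rw [nsmul_eq_mul]
    gcongr
    have := (Finset.card_union_le _ _).trans (add_le_add (hM x) (hM y))
    calc _ ≤ ((M + M : ℕ) : ℝ≥0∞) := by exact_mod_cast this
      _ = 2 * M := by push_cast; ring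
  calc P.card * ENNReal.ofReal δ = ∑ _s ∈ P, ENNReal.ofReal δ := by simp
    _ ≤ ∑ s ∈ P, ∑' e : G.edgeSet, edgeLength (φ s) (e : Sym2 (Pt d)) := by
        refine Finset.sum_le_sum fun s hs => ?_
        obtain ⟨q, hq, ⟨w⟩⟩ := hG s hs
        refine le_trans ?_ (edist_le_tsum_edgeLength (φ s) w)
        rw [edist_dist]
        refine ENNReal.ofReal_le_ofReal ?_
        have h1 : φ s s = 0 := by simp [φ, hδ0.trans hδ]
        have h2 : δ ≤ φ s q := le_min hq hδ
        rw [h1, dist_zero_left]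
        exact h2.trans (le_abs_self _)
    _ = ∑' e : G.edgeSet, ∑ s ∈ P, edgeLength (φ s) (e : Sym2 (Pt d)) :=
        (Summable.tsum_finsetSum fun _ _ => ENNReal.summable).symm
    _ ≤ ∑' e : G.edgeSet, 2 * M * edgeLength id (e : Sym2 (Pt d)) :=
        ENNReal.tsum_le_tsum fun e => hedge e
    _ = _ := by rw [ENNReal.tsum_mul_left, weight_eq]

/-! ### Existence of incremental quadtrees -/

/-- The relative position of the first point in the root cubes of side `2 ^ k`: doubling a cube
either upwards or downwards keeps it between `1 / 4` and `3 / 4`. -/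
noncomputable def offset : ℕ → ℝ
  | 0 => 1 / 2
  | k + 1 => if offset k < 1 / 2 then offset k / 2 + 1 / 2 else offset k / 2

theorem offset_mem (k : ℕ) : 1 / 4 ≤ offset k ∧ offset k ≤ 3 / 4 := by
  induction k with
  | zero => norm_num [offset]
  | succ k ih =>
    rw [offset]
    split_ifs with h <;> constructor <;> linarith [ih.1, ih.2]

theorem exists_offset_succ (k : ℕ) : ∃ z : ℕ, z < 2 ∧ 2 * offset (k + 1) = offset k + z := by
  rw [offset]
  split_ifs with h
  · exact ⟨1, by norm_num, by push_cast; ring⟩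
  · exact ⟨0, by norm_num, by push_cast; ring⟩

/-- An increasing chain of cubes around `s`, each of which is a cell of the next one. -/
noncomputable def chainCube {d : ℕ} (s : Pt d) (D : ℝ) (k : ℕ) : Cube d where
  corner := WithLp.toLp 2 fun i => s i - offset k * (4 * D * 2 ^ k)
  side := 4 * D * 2 ^ k

/-- The offset bounds leave a margin of at least a quarter of the side `4 * D * 2 ^ k` on both sides
of `s`. Strictness matters because cubes are half-open. -/
theorem mem_chainCube {d : ℕ} {s x : Pt d} {D : ℝ} {k : ℕ} (h : dist s x < D * 2 ^ k) :
    x ∈ (chainCube s D k).carrier := by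
  intro i
  have h1 := abs_le.1 (abs_sub_apply_le_dist s x i)
  have hD : 0 ≤ D * 2 ^ k := dist_nonneg.trans h.le
  have h2 := mul_le_mul_of_nonneg_right (offset_mem k).1 hD
  have h3 := mul_le_mul_of_nonneg_right (offset_mem k).2 hD
  simp only [chainCube]
  constructor <;> linarith [h1.1, h1.2]

theorem chainCube_mem_cells {d : ℕ} (s : Pt d) (D : ℝ) {k m : ℕ} (h : k ≤ m) :
    ∃ l, chainCube s D k ∈ (chainCube s D m).cells l := by
  induction m, h using Nat.le_induction with
  | base => exact ⟨0, by simp, fun _ => 0, by simp⟩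
  | succ m _ ih =>
    obtain ⟨l, hl⟩ := ih
    refine ⟨1 + l, Cube.mem_cells_trans ?_ hl⟩
    obtain ⟨z, hz, hoff⟩ := exists_offset_succ m
    refine ⟨by simp only [chainCube]; ring, fun _ => z, fun i => ⟨by simpa using hz, ?_⟩⟩
    simp only [chainCube]
    have h1 : (z : ℝ) = 2 * offset (m + 1) - offset m := by linarith
    rw [h1]
    ring

open scoped Classical in
/-- The distance of the first point of a list to the first point that differs from it. -/
noncomputable def baseDist {d : ℕ} (σ : List (Pt d)) : ℝ :=
  (σ.find? fun x => x ≠ σ.headD 0).elim 1 (dist (σ.headD 0))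

theorem baseDist_pos {d : ℕ} (σ : List (Pt d)) : 0 < baseDist σ := by
  classical
  rw [baseDist]
  cases h : σ.find? fun x => x ≠ σ.headD 0 with
  | none => simp
  | some q =>
    have := List.find?_some h
    simp only [ne_eq, decide_not, Bool.not_eq_eq_eq_not, Bool.not_true, decide_eq_false_iff_not]
      at this
    simpa using Ne.symm this

theorem headD_mem_pts {d : ℕ} {σ : List (Pt d)} (h : (pts σ).Nontrivial) :
    σ.headD 0 ∈ pts σ := by
  cases σ with
  | nil => exact absurd h (by simp [pts])
  | cons s τ => simp [pts]

theorem headD_append {d : ℕ} {σ : List (Pt d)} (h : (pts σ).Nontrivial) (τ : List (Pt d)) :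
    (σ ++ τ).headD 0 = σ.headD 0 := by
  cases σ with
  | nil => exact absurd h (by simp [pts])
  | cons s τ => simp

/-- The scale of the chain is frozen once two distinct points are present, and it is then an actual
distance between points; the default `1` is no longer used. -/
theorem exists_find?_ne_headD {d : ℕ} {σ : List (Pt d)} (h : (pts σ).Nontrivial) :
    ∃ q ∈ pts σ, ∀ τ, baseDist (σ ++ τ) = dist (σ.headD 0) q := by
  classical
  cases hq : σ.find? fun x => x ≠ σ.headD 0 with
  | none =>
    obtain ⟨x, hx, hne⟩ := h.exists_ne (σ.headD 0)
    have := List.find?_eq_none.1 hq x hx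
    simp_all
  | some q =>
    refine ⟨q, List.mem_of_find?_eq_some hq, fun τ => ?_⟩
    rw [baseDist, headD_append h, List.find?_append, hq]
    simp

/-- The first cube of the chain that contains all points. -/
noncomputable def rootIndex {d : ℕ} (σ : List (Pt d)) : ℕ :=
  sInf {k | pts σ ⊆ (chainCube (σ.headD 0) (baseDist σ) k).carrier}

theorem pts_subset_chainCube {d : ℕ} (σ : List (Pt d)) :
    pts σ ⊆ (chainCube (σ.headD 0) (baseDist σ) (rootIndex σ)).carrier := by
  refine Nat.sInf_mem (s := {k | pts σ ⊆ (chainCube (σ.headD 0) (baseDist σ) k).carrier}) ?_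
  have hfin : (pts σ).Finite := List.finite_toSet σ
  obtain ⟨B, hB⟩ := (hfin.image (dist (σ.headD 0))).bddAbove
  obtain ⟨k, hk⟩ := pow_unbounded_of_one_lt (B / baseDist σ) (one_lt_two (α := ℝ))
  refine ⟨k, fun x hx => mem_chainCube ?_⟩
  rw [div_lt_iff₀' (baseDist_pos σ)] at hk
  exact (hB ⟨x, hx, rfl⟩).trans_lt hk

open scoped Classical in
/-- Roots taken from the chain of cubes around the first point, and the earliest point of a cube
as its representative. -/
noncomputable def chainQuadtree (d : ℕ) : IncrementalQuadtree d 8 where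
  root σ := chainCube (σ.headD 0) (baseDist σ) (rootIndex σ)
  rep σ Q := (σ.find? fun x => x ∈ Q.carrier).getD 0
  side_pos σ := by
    have := baseDist_pos σ
    simp only [chainCube]
    positivity
  subset_root := pts_subset_chainCube
  side_le σ h := by
    have hfin : (pts σ).Finite := List.finite_toSet σ
    have hdist : ∀ x ∈ pts σ, dist (σ.headD 0) x ≤ Metric.diam (pts σ) := fun x hx =>
      Metric.dist_le_diam_of_mem hfin.isBounded (headD_mem_pts h) hx
    simp only [chainCube]
    -- At index `0` the side is four times an actual distance. At index `k + 1` the previous cube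
    -- missed a point, which lies at distance at least `baseDist σ * 2 ^ k`, an eighth of the side.
    cases hk : rootIndex σ with
    | zero =>
      obtain ⟨q, hq, hb⟩ := exists_find?_ne_headD h
      have h1 := hb []
      rw [List.append_nil] at h1
      have h2 := hdist q hq
      have h3 := (dist_nonneg (x := σ.headD 0) (y := q)).trans h2
      rw [pow_zero, h1]
      linarith
    | succ k =>
      have hn : k ∉ {k | pts σ ⊆ (chainCube (σ.headD 0) (baseDist σ) k).carrier} :=
        Nat.notMem_of_lt_sInf (by rw [← rootIndex, hk]; exact Nat.lt_succ_self k)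
      obtain ⟨x, hx, hxn⟩ := Set.not_subset.1 hn
      have h1 : baseDist σ * 2 ^ k ≤ dist (σ.headD 0) x := by
        by_contra hlt
        exact hxn (mem_chainCube (not_le.1 hlt))
      have h2 := hdist x hx
      rw [pow_succ]
      linarith
  root_mem_cells σ p h := by
    obtain ⟨q, -, hb⟩ := exists_find?_ne_headD h
    have h1 := hb []
    rw [List.append_nil] at h1
    have hbase : baseDist (σ ++ [p]) = baseDist σ := (hb [p]).trans h1.symm
    have hsub := pts_subset_chainCube (σ ++ [p])
    rw [headD_append h, hbase] at hsub
    rw [headD_append h, hbase]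
    -- Both roots lie in the same chain, and a new point can only increase the index.
    refine chainCube_mem_cells _ _ (Nat.sInf_le fun x hx => hsub ?_)
    exact List.mem_append_left _ hx
  rep_mem σ l Q _ h := by
    obtain ⟨x, hxQ, hx⟩ := h
    cases hf : σ.find? fun x => x ∈ Q.carrier with
    | none => exact absurd hxQ (by simpa using List.find?_eq_none.1 hf x hx)
    | some y => exact ⟨by simpa using List.find?_some hf, List.mem_of_find?_eq_some hf⟩
  rep_append σ p l _ Q _ h := by
    obtain ⟨x, hxQ, hx⟩ := h
    cases hf : σ.find? fun x => x ∈ Q.carrier with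
    | none => exact absurd hxQ (by simpa using List.find?_eq_none.1 hf x hx)
    | some y => rw [List.find?_append, hf]; rfl

/-! ### The spanner property -/

theorem walkLength_append {d : ℕ} {G : SimpleGraph (Pt d)} {a b c : Pt d} (w : G.Walk a b)
    (w' : G.Walk b c) : walkLength (w.append w') = walkLength w + walkLength w' := by
  simp [walkLength, SimpleGraph.Walk.darts_append]

theorem walkLength_toWalk {d : ℕ} {G : SimpleGraph (Pt d)} {a b : Pt d} (h : G.Adj a b) :
    walkLength h.toWalk = dist a b := by
  simp [walkLength]

/-- If the old root is a level `k` cell of the new one, old level `l` becomes level `k + l` with the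
same cell side, so the length window of its edges is unchanged. -/
theorem IncrementalQuadtree.spanner_mono {d : ℕ} {κ : ℝ} (T : IncrementalQuadtree d κ)
    (c₁ c₂ ε : ℝ) (σ : List (Pt d)) (p : Pt d) :
    T.spanner c₁ c₂ ε σ ≤ T.spanner c₁ c₂ ε (σ ++ [p]) := by
  intro a b hab
  obtain ⟨hne, l, Q₁, h₁, Q₂, h₂, n₁, n₂, ha, hb, hl, hu⟩ := hab
  have hnt : (pts σ).Nontrivial :=
    ⟨a, ha ▸ (T.rep_mem σ l Q₁ h₁ n₁).2, b, hb ▸ (T.rep_mem σ l Q₂ h₂ n₂).2, hne⟩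
  obtain ⟨k, hk⟩ := T.root_mem_cells σ p hnt
  have hsub : pts σ ⊆ pts (σ ++ [p]) := fun x hx => List.mem_append_left _ hx
  have hscale : ∀ c : ℝ, c * (T.root (σ ++ [p])).side / (ε * 2 ^ (k + l)) =
      c * (T.root σ).side / (ε * 2 ^ l) := by
    intro c
    rw [Cube.side_of_mem_cells hk, pow_add]
    field_simp
  exact ⟨hne, k + l, Q₁, Cube.mem_cells_trans hk h₁, Q₂, Cube.mem_cells_trans hk h₂,
    n₁.mono (Set.inter_subset_inter_right _ hsub), n₂.mono (Set.inter_subset_inter_right _ hsub),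
    ha.trans (T.rep_append σ p l hnt Q₁ h₁ n₁).symm,
    hb.trans (T.rep_append σ p l hnt Q₂ h₂ n₂).symm, by rwa [hscale], by rwa [hscale]⟩

/-- The least level satisfying the first inequality works: its predecessor fails, and at level `0`
the second inequality is `hK`. -/
theorem exists_level {A D K : ℝ} (hA : 0 < A) (hD : 0 < D) (hK : D ≤ 2 * (K * A)) :
    ∃ l : ℕ, K * (A / 2 ^ l) ≤ D ∧ D ≤ 2 * (K * (A / 2 ^ l)) := by
  classical
  have hex : ∃ l : ℕ, K * (A / 2 ^ l) ≤ D := by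
    obtain ⟨l, hl⟩ := pow_unbounded_of_one_lt (K * A / D) (one_lt_two (α := ℝ))
    refine ⟨l, ?_⟩
    rw [div_lt_iff₀ hD] at hl
    rw [← mul_div_assoc, div_le_iff₀ (by positivity)]
    linarith
  refine ⟨Nat.find hex, Nat.find_spec hex, ?_⟩
  cases hm : Nat.find hex with
  | zero => simpa using hK
  | succ m =>
    have h := Nat.find_min hex (m := m) (by omega)
    rw [not_le] at h
    have h2 : 2 * (K * (A / 2 ^ (m + 1))) = K * (A / 2 ^ m) := by rw [pow_succ]; field_simp
    rw [h2]
    exact h.le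

theorem IncrementalQuadtree.isSpanner_spanner {d : ℕ} (hd : 0 < d) {κ : ℝ}
    (T : IncrementalQuadtree d κ) {ε : ℝ} (hε : 0 < ε) (hε1 : ε ≤ 1) (σ : List (Pt d)) :
    IsSpanner (1 + ε) (pts σ) (T.spanner (4 * √d) (14 * √d) ε σ) := by
  refine ⟨fun a b hab => ?_, ?_⟩
  · obtain ⟨-, l, Q₁, h₁, Q₂, h₂, n₁, n₂, ha, hb, -⟩ := hab
    exact ⟨ha ▸ (T.rep_mem σ l Q₁ h₁ n₁).2, hb ▸ (T.rep_mem σ l Q₂ h₂ n₂).2⟩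
  set G := T.spanner (4 * √d) (14 * √d) ε σ with hG
  by_contra hbad
  let bad : Set (Pt d × Pt d) := {x | x.1 ∈ pts σ ∧ x.2 ∈ pts σ ∧
    ¬ ∃ w : G.Walk x.1 x.2, walkLength w ≤ (1 + ε) * dist x.1 x.2}
  have hfin : bad.Finite := by
    have h : (pts σ).Finite := List.finite_toSet σ
    exact (h.prod h).subset fun x hx => ⟨hx.1, hx.2.1⟩
  have hne : bad.Nonempty := by
    push Not at hbad
    obtain ⟨a, ha, b, hb, h⟩ := hbad
    exact ⟨(a, b), ha, hb, by simpa using h⟩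
  obtain ⟨⟨a, b⟩, ⟨ha, hb, hab⟩, hmin⟩ :=
    Set.exists_min_image bad (fun x => dist x.1 x.2) hfin hne
  simp only at ha hb hab hmin
  have hshort : ∀ x ∈ pts σ, ∀ y ∈ pts σ, dist x y < dist a b →
      ∃ w : G.Walk x y, walkLength w ≤ (1 + ε) * dist x y := by
    intro x hx y hy hxy
    by_contra hn
    exact absurd (hmin (x, y) ⟨hx, hy, hn⟩) (not_le.2 hxy)
  have hD : 0 < dist a b := by
    rw [dist_pos]
    rintro rfl
    exact hab ⟨SimpleGraph.Walk.nil, by simp [walkLength]⟩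
  have hs : 0 < √(d : ℝ) := Real.sqrt_pos.2 (by exact_mod_cast hd)
  have hA := T.side_pos σ
  set A := (T.root σ).side with hAdef
  have hroot : dist a b ≤ √d * A :=
    Cube.dist_le (T.subset_root σ ha) (T.subset_root σ hb) hA.le
  have hAε : A ≤ A / ε := by rw [le_div_iff₀ hε]; nlinarith
  -- With `t` the cell side over `ε`, this gives `6√d t ≤ dist a b ≤ 12√d t`. Cells have diameter at
  -- most `√d ε t ≤ √d t`, so moving both ends to representatives keeps the distance in `[4√d t,
  -- 14√d t]`.
  obtain ⟨l, hl, hu⟩ := exists_level (A := A / ε) (K := 6 * √d) (by positivity) hD (by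
    nlinarith [mul_le_mul_of_nonneg_left hAε hs.le])
  obtain ⟨Q₁, h₁, ha₁⟩ := Cube.exists_mem_cells hA (T.subset_root σ ha) l
  obtain ⟨Q₂, h₂, hb₂⟩ := Cube.exists_mem_cells hA (T.subset_root σ hb) l
  set t := A / ε / 2 ^ l with ht
  have htpos : 0 < t := by positivity
  have hside : A / 2 ^ l = ε * t := by rw [ht]; field_simp
  have hr₁ := T.rep_mem σ l Q₁ h₁ ⟨a, ha₁, ha⟩
  have hr₂ := T.rep_mem σ l Q₂ h₂ ⟨b, hb₂, hb⟩
  set a' := T.rep σ Q₁ with ha'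
  set b' := T.rep σ Q₂ with hb'
  have hda : dist a a' ≤ √d * (ε * t) := by
    rw [← hside, ← h₁.1]
    exact Cube.dist_le ha₁ hr₁.1 (by rw [h₁.1]; positivity)
  have hdb : dist b' b ≤ √d * (ε * t) := by
    rw [← hside, ← h₂.1]
    exact Cube.dist_le hr₂.1 hb₂ (by rw [h₂.1]; positivity)
  have hst : 0 < √d * t := by positivity
  have hεst : √d * (ε * t) ≤ √d * t := by
    have := mul_le_mul_of_nonneg_right hε1 hst.le
    linarith
  obtain ⟨w₁, hw₁⟩ := hshort a ha a' hr₁.2 (by linarith)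
  obtain ⟨w₂, hw₂⟩ := hshort b' hr₂.2 b hb (by linarith)
  have htri1 : dist a b ≤ dist a a' + dist a' b' + dist b' b := dist_triangle4 _ _ _ _
  have htri2 : dist a' b' ≤ dist a a' + dist a b + dist b' b := by
    have := dist_triangle4 a' a b b'
    rwa [dist_comm a' a, dist_comm b b'] at this
  have hc : ∀ c : ℝ, c * A / (ε * 2 ^ l) = c * t := by
    intro c
    rw [ht]
    field_simp
  have hadj : G.Adj a' b' := by
    refine ⟨?_, l, Q₁, h₁, Q₂, h₂, ⟨a, ha₁, ha⟩, ⟨b, hb₂, hb⟩, rfl, rfl, ?_, ?_⟩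
    · rw [← dist_pos]; linarith
    · rw [hc]; linarith
    · rw [hc]; linarith
  -- The two outer paths cost at most `2√d ε t` each, and the edge exceeds `dist a b` by at most
  -- `2√d ε t`; the total excess `6√d ε t` is at most `ε * dist a b`.
  refine hab ⟨w₁.append (hadj.toWalk.append w₂), ?_⟩
  rw [walkLength_append, walkLength_append, walkLength_toWalk]
  have h1 : ε * (6 * √d * t) ≤ ε * dist a b := mul_le_mul_of_nonneg_left hl hε.le
  have h2 : (1 + ε) * dist a a' ≤ 2 * (√d * (ε * t)) :=
    mul_le_mul (by linarith) hda dist_nonneg (by norm_num)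
  have h3 : (1 + ε) * dist b' b ≤ 2 * (√d * (ε * t)) :=
    mul_le_mul (by linarith) hdb dist_nonneg (by norm_num)
  linarith

/-! ### The competitive ratio -/

namespace IncrementalQuadtree

variable {d : ℕ} {κ : ℝ} (T : IncrementalQuadtree d κ)

open scoped Classical in
/-- The representatives of the nonempty cubes at level `l`. -/
noncomputable def reps (σ : List (Pt d)) (l : ℕ) : Finset (Pt d) :=
  σ.toFinset.filter fun x => ∃ Q ∈ (T.root σ).cells l,
    (Q.carrier ∩ pts σ).Nonempty ∧ x = T.rep σ Q

theorem rep_mem_reps {σ : List (Pt d)} {l : ℕ} {Q : Cube d} (hQ : Q ∈ (T.root σ).cells l)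
    (hn : (Q.carrier ∩ pts σ).Nonempty) : T.rep σ Q ∈ T.reps σ l := by
  classical
  exact Finset.mem_filter.2 ⟨List.mem_toFinset.2 (T.rep_mem σ l Q hQ hn).2, Q, hQ, hn, rfl⟩

theorem mem_pts_of_mem_reps {σ : List (Pt d)} {l : ℕ} {x : Pt d} (hx : x ∈ T.reps σ l) :
    x ∈ pts σ := by
  classical
  exact List.mem_toFinset.1 (Finset.mem_filter.1 hx).1

theorem card_reps_le (σ : List (Pt d)) (l : ℕ) : (T.reps σ l).card ≤ σ.length := by
  classical
  exact (Finset.card_filter_le _ _).trans (List.toFinset_card_le σ)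

theorem reps_nonempty {σ : List (Pt d)} (h : (pts σ).Nonempty) (l : ℕ) :
    (T.reps σ l).Nonempty := by
  obtain ⟨x, hx⟩ := h
  obtain ⟨Q, hQ, hxQ⟩ := Cube.exists_mem_cells (T.side_pos σ) (T.subset_root σ hx) l
  exact ⟨_, T.rep_mem_reps hQ ⟨x, hxQ, hx⟩⟩

theorem card_reps_filter_le (σ : List (Pt d)) (l : ℕ) {r : ℝ} (hr : 0 ≤ r) (x : Pt d) :
    (((T.reps σ l).filter fun y => dist x y ≤ r).card : ℝ) ≤
      (2 * (r / ((T.root σ).side / 2 ^ l)) + 2) ^ d := by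
  classical
  have hA := T.side_pos σ
  refine card_filter_dist_le _ (T.root σ).corner (by positivity) hr ?_ x
  intro x hx y hy hxy
  obtain ⟨-, Q, hQ, hn, rfl⟩ := Finset.mem_filter.1 hx
  obtain ⟨-, Q', hQ', hn', rfl⟩ := Finset.mem_filter.1 hy
  rw [Cube.eq_of_floor_eq hA hQ hQ' (T.rep_mem σ l Q hQ hn).1 (T.rep_mem σ l Q' hQ' hn').1
    fun i => congrFun hxy i]

/-- The edges of one level. -/
def levelGraph (c₁ c₂ ε : ℝ) (σ : List (Pt d)) (l : ℕ) : SimpleGraph (Pt d) where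
  Adj a b := a ≠ b ∧ T.LevelEdge c₁ c₂ ε σ l a b
  symm := ⟨fun _ _ h => ⟨h.1.symm, h.2.symm⟩⟩
  loopless := ⟨fun _ h => h.1 rfl⟩

theorem weight_spanner_le (c₁ c₂ ε : ℝ) (σ : List (Pt d)) :
    weight (T.spanner c₁ c₂ ε σ) ≤ ∑' l, weight (T.levelGraph c₁ c₂ ε σ l) := by
  have h : (T.spanner c₁ c₂ ε σ).edgeSet = ⋃ l, (T.levelGraph c₁ c₂ ε σ l).edgeSet := by
    ext e
    induction e with | _ a b =>
    simp [spanner, levelGraph]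
  rw [weight_eq, h]
  exact ENNReal.tsum_iUnion_le_tsum (edgeLength id) _

theorem weight_levelGraph_le {c₁ c₂ ε : ℝ} (hc₂ : 0 < c₂) (hε : 0 < ε) (hε1 : ε ≤ 1)
    (σ : List (Pt d)) (l : ℕ) :
    weight (T.levelGraph c₁ c₂ ε σ l) ≤ ENNReal.ofReal (((2 * c₂ + 2) / ε) ^ d * (c₂ / ε)) *
      ((T.reps σ l).card * ENNReal.ofReal ((T.root σ).side / 2 ^ l)) := by
  classical
  have hA := T.side_pos σ
  set a := (T.root σ).side / 2 ^ l with ha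
  have hapos : 0 < a := by positivity
  set r := c₂ / ε * a with hr
  have hrpos : 0 < r := by positivity
  let F : Finset (Pt d × Pt d) :=
    (T.reps σ l).biUnion fun x => ((T.reps σ l).filter fun y => dist x y ≤ r).image (Prod.mk x)
  have hsub : (T.levelGraph c₁ c₂ ε σ l).edgeSet ⊆
      ((F.image Sym2.mk.uncurry : Finset _) : Set _) := by
    intro e
    induction e with | _ x y =>
    rintro ⟨-, Q₁, h₁, Q₂, h₂, n₁, n₂, rfl, rfl, -, hu⟩
    have hu' : c₂ * (T.root σ).side / (ε * 2 ^ l) = r := by rw [hr, ha]; field_simp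
    rw [hu'] at hu
    refine Finset.mem_coe.2 (Finset.mem_image.2 ⟨(T.rep σ Q₁, T.rep σ Q₂), ?_, rfl⟩)
    exact Finset.mem_biUnion.2 ⟨_, T.rep_mem_reps h₁ n₁, Finset.mem_image.2 ⟨_,
      Finset.mem_filter.2 ⟨T.rep_mem_reps h₂ n₂, hu⟩, rfl⟩⟩
  have hlen : ∀ e ∈ F.image Sym2.mk.uncurry, edgeLength id e ≤ ENNReal.ofReal r := by
    intro e he
    obtain ⟨⟨x, y⟩, hxy, rfl⟩ := Finset.mem_image.1 he
    obtain ⟨x', -, hx'⟩ := Finset.mem_biUnion.1 hxy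
    obtain ⟨y', hy', heq⟩ := Finset.mem_image.1 hx'
    obtain ⟨rfl, rfl⟩ := Prod.mk.inj heq
    change edist x' y' ≤ _
    rw [edist_dist]
    exact ENNReal.ofReal_le_ofReal (Finset.mem_filter.1 hy').2
  have hF : (F.card : ℝ) ≤ (T.reps σ l).card * ((2 * c₂ + 2) / ε) ^ d := by
    calc (F.card : ℝ)
        ≤ ∑ x ∈ T.reps σ l, (((T.reps σ l).filter fun y => dist x y ≤ r).card : ℝ) := by
          exact_mod_cast Finset.card_biUnion_le.trans
            (Finset.sum_le_sum fun x _ => Finset.card_image_le)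
      _ ≤ ∑ _x ∈ T.reps σ l, ((2 * c₂ + 2) / ε) ^ d := by
          refine Finset.sum_le_sum fun x _ => (T.card_reps_filter_le σ l hrpos.le x).trans ?_
          refine pow_le_pow_left₀ (by positivity) ?_ d
          rw [← ha, hr, mul_div_cancel_right₀ _ hapos.ne', add_div, mul_div_assoc]
          gcongr
          rw [le_div_iff₀ hε]
          linarith
      _ = _ := by simp
  calc weight (T.levelGraph c₁ c₂ ε σ l)
      ≤ ∑' e : ((F.image Sym2.mk.uncurry : Finset _) : Set (Sym2 (Pt d))),
          edgeLength id (e : Sym2 (Pt d)) :=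
        ENNReal.tsum_mono_subtype _ hsub
    _ = ∑ e ∈ F.image Sym2.mk.uncurry, edgeLength id e := Finset.tsum_subtype' _ _
    _ ≤ (F.image Sym2.mk.uncurry).card * ENNReal.ofReal r := by
        rw [← nsmul_eq_mul]
        exact Finset.sum_le_card_nsmul _ _ _ hlen
    _ ≤ F.card * ENNReal.ofReal r := by
        gcongr
        exact Finset.card_image_le
    _ = ENNReal.ofReal (F.card * r) := by
        rw [ENNReal.ofReal_mul (Nat.cast_nonneg _), ENNReal.ofReal_natCast]
    _ ≤ ENNReal.ofReal (((2 * c₂ + 2) / ε) ^ d * (c₂ / ε) * ((T.reps σ l).card * a)) := by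
        refine ENNReal.ofReal_le_ofReal ?_
        calc F.card * r ≤ ((T.reps σ l).card * ((2 * c₂ + 2) / ε) ^ d) * r :=
              mul_le_mul_of_nonneg_right hF hrpos.le
          _ = _ := by rw [hr]; ring
    _ = _ := by
        rw [ENNReal.ofReal_mul (by positivity), ENNReal.ofReal_mul (Nat.cast_nonneg _),
          ENNReal.ofReal_natCast]

/-- Only the connectivity of the spanner is used, so the bound holds for every stretch `t`. Packing
at radius `a` gives `M = 4 ^ d`. -/
theorem card_reps_mul_side_le {κ' : ℝ} {σ : List (Pt d)}
    (hκ1 : 1 ≤ κ') (hside : (T.root σ).side ≤ κ' * Metric.diam (pts σ))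
    {t : ℝ} {G : SimpleGraph (Pt d)} (hG : IsSpanner t (pts σ) G) (l : ℕ) :
    (T.reps σ l).card * ENNReal.ofReal ((T.root σ).side / 2 ^ l) ≤
      ENNReal.ofReal (2 * 4 ^ (d + 1) * κ') * weight G := by
  have hκ : 0 < κ' := one_pos.trans_le hκ1
  have hA := T.side_pos σ
  set a := (T.root σ).side / 2 ^ l with ha
  have hapos : 0 < a := by positivity
  have haA : a ≤ (T.root σ).side := div_le_self hA.le (one_le_pow₀ (by norm_num))
  have hM : ∀ x, ((T.reps σ l).filter fun y => dist x y ≤ a).card ≤ 4 ^ d := by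
    intro x
    have h := T.card_reps_filter_le σ l hapos.le x
    rw [← ha, div_self hapos.ne'] at h
    norm_num at h
    exact_mod_cast h
  have hδ : a / (4 * κ') ≤ a := div_le_self hapos.le (by linarith)
  -- If all points were within `a / (4 * κ')` of `s`, the diameter would be at most `a / (2 * κ')`
  -- and the root side at most `a / 2`, less than the cell side `a`.
  have h := card_mul_le_weight (T.reps σ l) hδ (by positivity) hM G (by
    intro s hs
    have hsσ := T.mem_pts_of_mem_reps hs
    by_contra hn
    push Not at hn
    have hlt : ∀ q ∈ pts σ, dist s q < a / (4 * κ') := by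
      intro q hq
      by_contra hq'
      obtain ⟨w, -⟩ := hG.2 s hsσ q hq
      exact (not_isEmpty_iff.2 ⟨w⟩) (hn q (not_lt.1 hq'))
    have hdiam : Metric.diam (pts σ) ≤ 2 * (a / (4 * κ')) := by
      refine Metric.diam_le_of_forall_dist_le (by positivity) fun x hx y hy => ?_
      have := dist_triangle_left x y s
      linarith [hlt x hx, hlt y hy]
    have h1 := mul_le_mul_of_nonneg_left hdiam hκ.le
    have h2 : κ' * (2 * (a / (4 * κ'))) = a / 2 := by field_simp; norm_num
    linarith)
  have hscale : ENNReal.ofReal a = ENNReal.ofReal (4 * κ') * ENNReal.ofReal (a / (4 * κ')) := by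
    rw [← ENNReal.ofReal_mul (by positivity), mul_div_cancel₀ _ (by positivity)]
  calc (T.reps σ l).card * ENNReal.ofReal a
      = ENNReal.ofReal (4 * κ') * ((T.reps σ l).card * ENNReal.ofReal (a / (4 * κ'))) := by
        rw [hscale]; ring
    _ ≤ ENNReal.ofReal (4 * κ') * (2 * (4 ^ d : ℕ) * weight G) := by gcongr
    _ = _ := by
        rw [← mul_assoc]
        congr 1
        have : (2 * ((4 ^ d : ℕ) : ℝ≥0∞)) = ENNReal.ofReal (2 * 4 ^ d) := by
          rw [ENNReal.ofReal_mul (by norm_num), ENNReal.ofReal_pow (by norm_num)]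
          norm_num
        rw [this, ← ENNReal.ofReal_mul (by positivity)]
        congr 1
        ring

end IncrementalQuadtree

/-- The first `Nat.clog 2 n` terms cost `B` each; from there on `n * 2⁻¹ ^ l ≤ 1`, and the geometric
tail adds `2 * B`. -/
theorem tsum_le_of_le_of_le_geometric {f : ℕ → ℝ≥0∞} {B : ℝ≥0∞} {n : ℕ} (h₁ : ∀ l, f l ≤ B)
    (h₂ : ∀ l, f l ≤ n * 2⁻¹ ^ l * B) : ∑' l, f l ≤ (Nat.clog 2 n + 2 : ℕ) * B := by
  set L := Nat.clog 2 n
  have hn : (n : ℝ≥0∞) * 2⁻¹ ^ L ≤ 1 := by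
    rw [← ENNReal.inv_pow, ← div_eq_mul_inv]
    refine ENNReal.div_le_of_le_mul ?_
    rw [one_mul]
    exact_mod_cast Nat.le_pow_clog one_lt_two n
  have htail : ∑' i, f (i + L) ≤ 2 * B := by
    calc ∑' i, f (i + L) ≤ ∑' i : ℕ, 2⁻¹ ^ i * B := by
          refine ENNReal.tsum_le_tsum fun i => (h₂ (i + L)).trans ?_
          calc (n : ℝ≥0∞) * 2⁻¹ ^ (i + L) * B = n * 2⁻¹ ^ L * (2⁻¹ ^ i * B) := by
                rw [pow_add]; ring
            _ ≤ 1 * (2⁻¹ ^ i * B) := by gcongr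
            _ = _ := one_mul _
      _ = 2 * B := by
          rw [ENNReal.tsum_mul_right, ENNReal.tsum_geometric, ENNReal.one_sub_inv_two, inv_inv]
  rw [← ENNReal.summable.sum_add_tsum_nat_add' (k := L)]
  calc ∑ i ∈ Finset.range L, f i + ∑' i, f (i + L)
      ≤ (Finset.range L).card • B + 2 * B :=
        add_le_add (Finset.sum_le_card_nsmul _ _ _ fun i _ => h₁ i) htail
    _ = _ := by rw [Finset.card_range, nsmul_eq_mul]; push_cast; ring

theorem clog_add_two_le {n : ℕ} (hn : 2 ≤ n) : ((Nat.clog 2 n + 2 : ℕ) : ℝ) ≤ 8 * Real.log n := by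
  have h2 := Real.log_two_gt_d9
  have hlog : Real.log 2 ≤ Real.log n := Real.log_le_log two_pos (by exact_mod_cast hn)
  have hpow : (2 : ℝ) ^ (Nat.clog 2 n - 1) ≤ n := by
    exact_mod_cast (Nat.pow_pred_clog_lt_self one_lt_two (by omega)).le
  have hm : ((Nat.clog 2 n - 1 : ℕ) : ℝ) * Real.log 2 ≤ Real.log n := by
    rw [← Real.log_pow]
    exact Real.log_le_log (by positivity) hpow
  have hle : ((Nat.clog 2 n + 2 : ℕ) : ℝ) ≤ ((Nat.clog 2 n - 1 : ℕ) : ℝ) + 3 := by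
    exact_mod_cast (by omega : Nat.clog 2 n + 2 ≤ Nat.clog 2 n - 1 + 3)
  have := (Nat.clog 2 n - 1).cast_nonneg (α := ℝ)
  nlinarith

theorem two_le_length {d : ℕ} {σ : List (Pt d)} (hσ : (pts σ).Nontrivial) : 2 ≤ σ.length := by
  classical
  obtain ⟨x, hx, y, hy, hxy⟩ := hσ
  have h1 : 1 < σ.toFinset.card :=
    Finset.one_lt_card.2 ⟨x, List.mem_toFinset.2 hx, y, List.mem_toFinset.2 hy, hxy⟩
  exact h1.trans_le (List.toFinset_card_le σ)

theorem IncrementalQuadtree.weight_spanner_le_mul_weight {d : ℕ} {κ : ℝ}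
    (T : IncrementalQuadtree d κ) {c₁ c₂ ε κ' : ℝ} (hc₂ : 0 < c₂) (hε : 0 < ε) (hε1 : ε ≤ 1)
    (hκ : κ ≤ κ') (hκ1 : 1 ≤ κ') {σ : List (Pt d)} (hσ : (pts σ).Nontrivial) {t : ℝ}
    {G : SimpleGraph (Pt d)} (hG : IsSpanner t (pts σ) G) :
    weight (T.spanner c₁ c₂ ε σ) ≤ ENNReal.ofReal
      (8 * ((2 * c₂ + 2) ^ d * c₂) * (2 * 4 ^ (d + 1) * κ') * (ε ^ (d + 1))⁻¹ *
        Real.log σ.length) * weight G := by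
  have hside : (T.root σ).side ≤ κ' * Metric.diam (pts σ) :=
    (T.side_le σ hσ).trans (mul_le_mul_of_nonneg_right hκ Metric.diam_nonneg)
  have hκ0 : 0 < κ' := by linarith
  have hA := T.side_pos σ
  have hlevel := T.card_reps_mul_side_le hκ1 hside hG
  set B := ENNReal.ofReal (2 * 4 ^ (d + 1) * κ') * weight G with hB
  -- Level `0` has at least one representative, so the lower bound there already pays for the root
  -- side.
  have hzero : ENNReal.ofReal (T.root σ).side ≤ B := by
    refine le_trans ?_ (hlevel 0)
    have h1 : (1 : ℝ≥0∞) ≤ (T.reps σ 0).card := by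
      exact_mod_cast (T.reps_nonempty hσ.nonempty 0).card_pos
    rw [pow_zero, div_one]
    exact le_mul_of_one_le_left' h1
  have hsum := tsum_le_of_le_of_le_geometric (n := σ.length) hlevel (by
    intro l
    have h2 : ENNReal.ofReal ((T.root σ).side / 2 ^ l) =
        2⁻¹ ^ l * ENNReal.ofReal (T.root σ).side := by
      rw [ENNReal.ofReal_div_of_pos (by positivity), ENNReal.ofReal_pow (by norm_num),
        ← ENNReal.inv_pow, div_eq_mul_inv, mul_comm]
      norm_num
    rw [h2, ← mul_assoc]
    gcongr
    exact T.card_reps_le σ l)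
  have hlog : 0 ≤ Real.log σ.length := Real.log_natCast_nonneg _
  calc weight (T.spanner c₁ c₂ ε σ)
      ≤ ∑' l, ENNReal.ofReal (((2 * c₂ + 2) / ε) ^ d * (c₂ / ε)) *
          ((T.reps σ l).card * ENNReal.ofReal ((T.root σ).side / 2 ^ l)) :=
        (T.weight_spanner_le c₁ c₂ ε σ).trans
          (ENNReal.tsum_le_tsum fun l => T.weight_levelGraph_le hc₂ hε hε1 σ l)
    _ ≤ ENNReal.ofReal (((2 * c₂ + 2) / ε) ^ d * (c₂ / ε)) *
          (ENNReal.ofReal (8 * Real.log σ.length) * B) := by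
        rw [ENNReal.tsum_mul_left]
        gcongr
        refine hsum.trans ?_
        gcongr
        rw [← ENNReal.ofReal_natCast]
        exact ENNReal.ofReal_le_ofReal (clog_add_two_le (two_le_length hσ))
    _ = _ := by
        rw [hB, ← mul_assoc, ← mul_assoc, ← ENNReal.ofReal_mul (by positivity),
          ← ENNReal.ofReal_mul (by positivity)]
        congr 2
        rw [div_pow, pow_succ ε]
        field_simp

theorem weight_spanner_of_not_nontrivial {d : ℕ} {κ : ℝ} (T : IncrementalQuadtree d κ)
    (c₁ c₂ ε : ℝ) {σ : List (Pt d)} (hσ : ¬ (pts σ).Nontrivial) :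
    weight (T.spanner c₁ c₂ ε σ) = 0 := by
  have h : T.spanner c₁ c₂ ε σ = ⊥ := by
    ext a b
    refine iff_of_false ?_ (by simp)
    rintro ⟨hne, l, Q₁, h₁, Q₂, h₂, n₁, n₂, ha, hb, -⟩
    exact hσ ⟨a, ha ▸ (T.rep_mem σ l Q₁ h₁ n₁).2, b, hb ▸ (T.rep_mem σ l Q₂ h₂ n₂).2, hne⟩
  rw [weight_eq, h, SimpleGraph.edgeSet_bot]
  exact tsum_empty

theorem IncrementalQuadtree.competitiveRatio_le {d : ℕ} {κ : ℝ} (T : IncrementalQuadtree d κ)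
    {c₁ c₂ ε κ' : ℝ} (hc₂ : 0 < c₂) (hε : 0 < ε) (hε1 : ε ≤ 1) (hκ : κ ≤ κ') (hκ1 : 1 ≤ κ')
    (t : ℝ) (n : ℕ) : competitiveRatio t (T.spanner c₁ c₂ ε) n ≤ ENNReal.ofReal
      (8 * ((2 * c₂ + 2) ^ d * c₂) * (2 * 4 ^ (d + 1) * κ') * (ε ^ (d + 1))⁻¹ * Real.log n) := by
  refine iSup₂_le fun σ hn => ?_
  by_cases hσ : (pts σ).Nontrivial
  · refine ENNReal.div_le_of_le_mul ?_
    set K := ENNReal.ofReal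
      (8 * ((2 * c₂ + 2) ^ d * c₂) * (2 * 4 ^ (d + 1) * κ') * (ε ^ (d + 1))⁻¹ * Real.log n)
      with hK
    have hbound : ∀ G, IsSpanner t (pts σ) G → weight (T.spanner c₁ c₂ ε σ) ≤ K * weight G := by
      intro G hG
      have h := T.weight_spanner_le_mul_weight (c₁ := c₁) hc₂ hε hε1 hκ hκ1 hσ hG
      rwa [hn, ← hK] at h
    have hlog : 0 < Real.log n :=
      Real.log_pos (by exact_mod_cast (hn ▸ two_le_length hσ : 1 < n))
    -- Moving `K` inside the infimum requires `K ≠ 0`; two distinct points force `n ≥ 2`, hence `log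
    -- n > 0`.
    have hK0 : K ≠ 0 := (ENNReal.ofReal_pos.2 (by positivity)).ne'
    rw [optWeight, ENNReal.mul_iInf_of_ne hK0 ENNReal.ofReal_ne_top]
    refine le_iInf fun G => ?_
    rw [ENNReal.mul_iInf_of_ne hK0 ENNReal.ofReal_ne_top]
    exact le_iInf fun hG => hbound G hG
  -- With at most one distinct point there are no edges and the quotient is `0`; this also covers `n
  -- ≤ 1`, where `log n = 0`.
  · rw [weight_spanner_of_not_nontrivial T c₁ c₂ ε hσ, ENNReal.zero_div]
    exact zero_le

end OnlineSpanner

open OnlineSpanner in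
theorem mainTheorem3 (d : ℕ) (hd : 2 ≤ d) :
    (∃ κ : ℝ, Nonempty (IncrementalQuadtree d κ)) ∧
    (∃ c₁ c₂ : ℝ, 0 < c₁ ∧ c₁ < c₂ ∧
      ∀ (κ : ℝ) (T : IncrementalQuadtree d κ) (ε : ℝ), 0 < ε → ε ≤ 1 →
        IsOnlineSpannerAlgorithm (1 + ε) (T.spanner c₁ c₂ ε)) ∧
    (∀ κ c₁ c₂ : ℝ, 0 < c₁ → c₁ < c₂ →
      ∃ C : ℝ, 0 < C ∧
        ∀ (T : IncrementalQuadtree d κ) (ε : ℝ), 0 < ε → ε ≤ 1 → ∀ n : ℕ,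
          competitiveRatio (1 + ε) (T.spanner c₁ c₂ ε) n ≤
            ENNReal.ofReal (C * (ε ^ (d + 1))⁻¹ * Real.log n)) := by
  have hs : 0 < √(d : ℝ) := Real.sqrt_pos.2 (by exact_mod_cast (by omega : 0 < d))
  refine ⟨⟨8, ⟨chainQuadtree d⟩⟩, ⟨4 * √d, 14 * √d, by positivity, by linarith,
    fun κ T ε hε hε1 => ⟨T.isSpanner_spanner (by omega) hε hε1,
      T.spanner_mono (4 * √d) (14 * √d) ε⟩⟩, fun κ c₁ c₂ hc₁ hc => ?_⟩
  have hc₂ : 0 < c₂ := hc₁.trans hc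
  have hκ : 0 < max κ 1 := lt_max_of_lt_right one_pos
  -- `max κ 1` replaces the arbitrary real `κ`, since the lower bound for the weight needs a
  -- constant of at least `1`.
  exact ⟨8 * ((2 * c₂ + 2) ^ d * c₂) * (2 * 4 ^ (d + 1) * max κ 1), by positivity,
    fun T ε hε hε1 n =>
      T.competitiveRatio_le hc₂ hε hε1 (le_max_left κ 1) (le_max_right κ 1) (1 + ε) n⟩
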